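/- Let $n\in\mathbb N$ and identify the Heisenberg group $\mathbb H^n$ with $\mathbb R^{2n}\times\mathbb R$. For $\lambda\in\mathbb R\setminus\{0\}$ put $$c_\lambda=(4\pi)^{-n}\lambda^n(\sinh\lambda)^{-n}.$$ For $t>0$ let $$p_t^\lambda(\zeta)=(4\pi)^{-n}\lambda^n(\sinh t\lambda)^{-n}\,e^{-\frac14\lambda(\coth t\lambda)\sum_{i=1}^{2n}\zeta_i^2},\qquad \zeta\in\mathbb C^{2n},$$ be the holomorphic extension of the kernel of the special Hermite semigroup on $\mathbb R^{2n}$. Let $[(z,w),(z',w')]=w\cdot z'-z\cdot w'$ be the (complex bilinear) symplectic form on $\mathbb C^{2n}$. For a function $g\in L^2(\mathbb R^{2n})$ the twisted Bargmann transform is $$B_\lambda g(\zeta)=c_\lambda\,p_1^\lambda(\zeta)^{-1}\int_{\mathbb R^{2n}}g(\eta)\,p_{1/2}^\lambda(\zeta-\eta)\,e^{-i\frac{\lambda}{2}[\zeta,\eta]}\,d\eta,\qquad\zeta\in\mathbb C^{2n},$$ that is, $c_\lambda (p_1^\lambda)^{-1}$ times the holomorphic extension of the $\lambda$-twisted convolution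 $g\ast_\lambda p_{1/2}^\lambda$. Let $$w_\lambda(\zeta)=c_\lambda\,e^{-\frac12\lambda(\coth\lambda)|\zeta|^2}\,e^{\lambda[\operatorname{Re}\zeta,\operatorname{Im}\zeta]}$$ be the weight of the corresponding twisted Fock space, and for a function $f$ on $\mathbb H^n$ let $f^\lambda(\xi)=\int_{\mathbb R}f(\xi,t)e^{i\lambda t}\,dt$. Let $f$ be a Schwartz function on $\mathbb H^n$. Then for all $m,N\in\mathbb N$ there is a constant $C_{m,N}(f)$, depending only on $n,m,N$ and $f$, such that for all $\lambda\in\mathbb R\setminus\{0\}$ and all $\zeta\in\mathbb C^{2n}$ $$|B_\lambda f^\lambda(\zeta)|\,\sqrt{w_\lambda(\zeta)}\le C_{m,N}(f)\,c_\lambda\,(1+\lambda^2)^{-m}\,e^{N|\lambda|}\,(1+|\zeta|)^{-N}.$$ -/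

import Mathlib

open scoped SchwartzMap

noncomputable section

namespace TwistedBargmann

/-- `ℝ²ⁿ`, with its Euclidean norm and Lebesgue measure. A point is `ξ = (x, u)` with
`x j = ξ (.inl j)` and `u j = ξ (.inr j)`. -/
abbrev R2 (n : ℕ) : Type := EuclideanSpace ℝ (Fin n ⊕ Fin n)

/-- `ℂ²ⁿ`, with its Euclidean norm. A point is `ζ = (z, w)` with `z j = ζ (.inl j)` and
`w j = ζ (.inr j)`. -/
abbrev C2 (n : ℕ) : Type := EuclideanSpace ℂ (Fin n ⊕ Fin n)

/-- The underlying manifold `ℝ²ⁿ × ℝ` of the Heisenberg group; the second factor is the central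
variable. -/
abbrev Heis (n : ℕ) : Type := R2 n × ℝ

/-- The inclusion `ℝ²ⁿ ⊆ ℂ²ⁿ`. -/
def toC {n : ℕ} (ξ : R2 n) : C2 n := WithLp.toLp 2 fun i => (ξ i : ℂ)

/-- The coordinatewise real part of `ζ ∈ ℂ²ⁿ`. -/
def rePart {n : ℕ} (ζ : C2 n) : R2 n := WithLp.toLp 2 fun i => (ζ i).re

/-- The coordinatewise imaginary part of `ζ ∈ ℂ²ⁿ`. -/
def imPart {n : ℕ} (ζ : C2 n) : R2 n := WithLp.toLp 2 fun i => (ζ i).im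

/-- The symplectic form `[(x, u), (y, v)] = u · y - v · x` on `ℝ²ⁿ`. -/
def symp {n : ℕ} (ξ η : R2 n) : ℝ :=
  ∑ j, (ξ (.inr j) * η (.inl j) - η (.inr j) * ξ (.inl j))

/-- The complex bilinear extension of the symplectic form to `ℂ²ⁿ`. -/
def sympC {n : ℕ} (ζ ζ' : C2 n) : ℂ :=
  ∑ j, (ζ (.inr j) * ζ' (.inl j) - ζ' (.inr j) * ζ (.inl j))

/-- The hyperbolic cotangent. -/
def coth (x : ℝ) : ℝ := Real.cosh x / Real.sinh x

/-- The constant `c_λ = (4π)⁻ⁿ λⁿ (sinh λ)⁻ⁿ`. -/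
def cConst (n : ℕ) (lam : ℝ) : ℝ :=
  ((4 * Real.pi) ^ n)⁻¹ * lam ^ n * (Real.sinh lam ^ n)⁻¹

/-- The kernel `p_t^λ` of the special Hermite semigroup, extended holomorphically to `ℂ²ⁿ`:
`|x|² + |u|²` becomes `∑ z_j² + ∑ w_j²`. -/
def heatKernel (n : ℕ) (t lam : ℝ) (ζ : C2 n) : ℂ :=
  ((((4 * Real.pi) ^ n)⁻¹ * lam ^ n * (Real.sinh (t * lam) ^ n)⁻¹ : ℝ) : ℂ) *
    Complex.exp (-(1 / 4) * (lam : ℂ) * (coth (t * lam) : ℂ) * ∑ i, ζ i ^ 2)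

/-- The `λ`-twisted convolution `g ∗_λ k` of a function `g` on `ℝ²ⁿ` with a function `k` that is
defined on `ℂ²ⁿ`, evaluated at points of `ℂ²ⁿ`:
`(g ∗_λ k)(ζ) = ∫ g(η) k(ζ - η) e^{-i (λ/2) [ζ, η]} dη`. -/
def twistedConv {n : ℕ} (lam : ℝ) (g : R2 n → ℂ) (k : C2 n → ℂ) (ζ : C2 n) : ℂ :=
  ∫ η : R2 n, g η * k (ζ - toC η) *
    Complex.exp (-Complex.I * ((lam : ℂ) / 2) * sympC ζ (toC η))

/-- The twisted Bargmann transform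
`B_λ g(ζ) = c_λ p_1^λ(ζ)⁻¹ (g ∗_λ p_{1/2}^λ)(ζ)`. -/
def bargmann {n : ℕ} (lam : ℝ) (g : R2 n → ℂ) (ζ : C2 n) : ℂ :=
  (cConst n lam : ℂ) * (heatKernel n 1 lam ζ)⁻¹ *
    twistedConv lam g (heatKernel n (1 / 2) lam) ζ

/-- The weight `w_λ(ζ) = c_λ e^{-(λ/2) (coth λ) |ζ|²} e^{λ [Re ζ, Im ζ]}` of the twisted Fock
space. -/
def weight {n : ℕ} (lam : ℝ) (ζ : C2 n) : ℝ :=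
  cConst n lam * Real.exp (-(1 / 2) * lam * coth lam * ‖ζ‖ ^ 2) *
    Real.exp (lam * symp (rePart ζ) (imPart ζ))

/-- The inverse Fourier transform in the central variable,
`f^λ(ξ) = ∫ f(ξ, t) e^{iλt} dt`. -/
def centralFourier {n : ℕ} (f : Heis n → ℂ) (lam : ℝ) (ξ : R2 n) : ℂ :=
  ∫ t : ℝ, f (ξ, t) * Complex.exp (Complex.I * (lam : ℂ) * (t : ℂ))

end TwistedBargmann

end

open scoped SchwartzMap

namespace TwistedBargmann

open MeasureTheory LineDeriv

/-! By Fubini, `B_λ f^λ(ζ)` is an explicit factor in `ζ` times the integral of `f` over the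
Heisenberg group against one exponential kernel, `fullKernel`. The factor together with `√w_λ` is
`damping`, so the quantity to bound is `damping` times `‖kernelPairing‖`.

Decay comes from three facts. Completing a square (`gaussian_exponent_nonpos`) shows that `damping`
times the kernel is at most `c_λ (1 + λ²)^n`, uniformly in `ζ` and in the integration point; this
settles the case without decay. Central derivatives of `f` bring down powers of `λ`, and `n` extra
factors of `1 + λ²` pay for the loss just mentioned. Finally, derivatives of `f` in `x_j` and `u_j`
give a 2×2 linear system for `z_j K` and `w_j K`, where `K` is the pairing with `f`. With `x = λ/2`,
its matrix has diagonal `x coth x`, off-diagonal entries `∓ix` and determinant `x² / sinh² x`.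
Inverting it (`norm_coord_mul_kernelPairing_le`) costs `e^{|λ|}` per power of `|ζ|`, which is the
source of `e^{N|λ|}`. Each right-hand side is a pairing with another Schwartz function, so one can
induct over all `f` at once. -/

/-! ### Hyperbolic functions and normalising constants. -/

theorem abs_sinh_le_exp (x : ℝ) : |Real.sinh x| ≤ Real.exp |x| := by
  rw [Real.abs_sinh, Real.sinh_eq]
  linarith [Real.exp_pos |x|, Real.exp_pos (-|x|)]

theorem cosh_le_exp_abs (x : ℝ) : Real.cosh x ≤ Real.exp |x| := by
  rw [← Real.cosh_abs, Real.cosh_eq]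
  have : Real.exp (-|x|) ≤ Real.exp |x| := Real.exp_le_exp.2 (by linarith [abs_nonneg x])
  linarith

theorem abs_sinh_le_abs_mul_exp (x : ℝ) : |Real.sinh x| ≤ |x| * Real.exp |x| := by
  rw [Real.abs_sinh, Real.sinh_eq]
  have h := Real.add_one_le_exp (-(2 * |x|))
  have h2 : Real.exp (-|x|) = Real.exp |x| * Real.exp (-(2 * |x|)) := by
    rw [← Real.exp_add]; ring_nf
  rw [h2]
  nlinarith [Real.exp_pos |x|]

theorem div_sinh_pos {x : ℝ} (hx : x ≠ 0) : 0 < x / Real.sinh x := by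
  rcases hx.lt_or_gt with h | h
  · exact div_pos_of_neg_of_neg h (Real.sinh_neg_iff.2 h)
  · exact div_pos h (Real.sinh_pos_iff.2 h)

theorem mul_coth_pos {x : ℝ} (hx : x ≠ 0) : 0 < x * coth x := by
  have h : x * coth x = x / Real.sinh x * Real.cosh x := by rw [coth]; ring
  rw [h]
  exact mul_pos (div_sinh_pos hx) (Real.cosh_pos x)

theorem mul_coth_le (x : ℝ) (hx : x ≠ 0) : x * coth x ≤ 1 + |x| := by
  have key : ∀ y : ℝ, 0 < y → y * coth y ≤ 1 + y := by
    intro y hy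
    have hs := Real.sinh_pos_iff.2 hy
    rw [coth, ← mul_div_assoc, div_le_iff₀ hs]
    -- Uses `y cosh y = y sinh y + y e^{-y}`, whose last term is at most `sinh y`.
    have h1 : y ≤ Real.sinh y := Real.self_le_sinh_iff.2 hy.le
    have h2 : Real.cosh y - Real.sinh y = Real.exp (-y) := by
      rw [Real.cosh_eq, Real.sinh_eq]; ring
    have h3 : Real.exp (-y) ≤ 1 := Real.exp_le_one_iff.2 (by linarith)
    nlinarith
  rcases hx.lt_or_gt with h | h
  · have := key (-x) (by linarith)
    rw [abs_of_neg h]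
    simpa [coth, Real.cosh_neg, Real.sinh_neg, neg_div, div_neg] using this
  · rw [abs_of_pos h]; exact key x h

theorem coth_double {x : ℝ} (hx : x ≠ 0) : coth (2 * x) = (coth x + (coth x)⁻¹) / 2 := by
  have hs := Real.sinh_ne_zero.2 hx
  have hc := (Real.cosh_pos x).ne'
  rw [coth, coth, Real.cosh_two_mul, Real.sinh_two_mul]
  field_simp

theorem cConst_pos (n : ℕ) {lam : ℝ} (h : lam ≠ 0) : 0 < cConst n lam := by
  have h1 := div_sinh_pos h
  have : cConst n lam = ((4 * Real.pi) ^ n)⁻¹ * (lam / Real.sinh lam) ^ n := by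
    rw [cConst, div_pow]; ring
  rw [this]; positivity

/-- The Gaussian prefactor of `p_t^λ`. -/
noncomputable def heatConst (n : ℕ) (t lam : ℝ) : ℝ :=
  ((4 * Real.pi) ^ n)⁻¹ * lam ^ n * (Real.sinh (t * lam) ^ n)⁻¹

theorem heatConst_half_pos (n : ℕ) {lam : ℝ} (h : lam ≠ 0) : 0 < heatConst n (1 / 2) lam := by
  have h1 := div_sinh_pos (x := 1 / 2 * lam) (by simpa using h)
  have : heatConst n (1 / 2) lam
      = ((4 * Real.pi) ^ n)⁻¹ * (2 * ((1 / 2 * lam) / Real.sinh (1 / 2 * lam))) ^ n := by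
    rw [heatConst, mul_assoc, ← inv_pow, ← mul_pow]; ring_nf
  rw [this]; positivity

/-- The duplication formula `sinh λ = 2 sinh (λ/2) cosh (λ/2)` turns the quotient of the constants
into a power of `(λ/2) coth (λ/2)`, which grows only linearly in `|λ|`. -/
theorem heatConst_half_sq (n : ℕ) {lam : ℝ} (h : lam ≠ 0) :
    heatConst n (1 / 2) lam ^ 2
      = cConst n lam * ((4 * Real.pi)⁻¹ * (4 * ((1 / 2 * lam) * coth (1 / 2 * lam)))) ^ n := by
  have hs : Real.sinh (1 / 2 * lam) ≠ 0 := Real.sinh_ne_zero.2 (by simpa using h)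
  have hc := (Real.cosh_pos (1 / 2 * lam)).ne'
  have hd : Real.sinh lam = 2 * Real.sinh (1 / 2 * lam) * Real.cosh (1 / 2 * lam) := by
    rw [← Real.sinh_two_mul]; ring_nf
  rw [heatConst, cConst, hd, coth]
  simp only [← inv_pow, ← mul_pow]
  rw [← pow_mul, mul_comm n 2, pow_mul]
  congr 1
  field_simp
  ring

theorem sqrt_cConst_mul_heatConst_le (n : ℕ) {lam : ℝ} (h : lam ≠ 0) :
    √(cConst n lam) * heatConst n (1 / 2) lam ≤ cConst n lam * (1 + lam ^ 2) ^ n := by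
  have hc := cConst_pos n h
  have hk : heatConst n (1 / 2) lam ≤ √(cConst n lam) * (1 + lam ^ 2) ^ n := by
    refine abs_le_of_sq_le_sq' ?_ (by positivity) |>.2
    rw [heatConst_half_sq n h, mul_pow (√_), Real.sq_sqrt hc.le]
    refine mul_le_mul_of_nonneg_left ?_ hc.le
    have h1 : (1 : ℝ) ≤ (1 + lam ^ 2) ^ n := one_le_pow₀ (by nlinarith [sq_nonneg lam])
    have h2 : ((4 * Real.pi)⁻¹ * (4 * ((1 / 2 * lam) * coth (1 / 2 * lam)))) ≤ 1 + lam ^ 2 := by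
      have h3 := mul_coth_le (1 / 2 * lam) (by simpa using h)
      have h4 : |1 / 2 * lam| ≤ 1 + 2 * lam ^ 2 := by
        rw [abs_le]; constructor <;> nlinarith [sq_nonneg (lam - 1), sq_nonneg (lam + 1)]
      have h5 := Real.pi_gt_three
      rw [inv_mul_le_iff₀ (by positivity)]
      nlinarith [sq_nonneg lam, mul_nonneg (sub_nonneg.2 h5.le) (sq_nonneg lam)]
    have h0 := mul_coth_pos (x := 1 / 2 * lam) (by simpa using h)
    calc _ ≤ (1 + lam ^ 2) ^ n := pow_le_pow_left₀ (by positivity) h2 n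
      _ ≤ _ := by nlinarith
  calc _ ≤ √(cConst n lam) * (√(cConst n lam) * (1 + lam ^ 2) ^ n) := by gcongr
    _ = _ := by rw [← mul_assoc, Real.mul_self_sqrt hc.le]

/-! ### The integral kernel and its directional derivatives. -/

/-- The kernel against which a function on the Heisenberg group is integrated to give the
twisted convolution of its partial Fourier transform with `p_{1/2}^λ`. -/
noncomputable def fullKernel {n : ℕ} (lam : ℝ) (ζ : C2 n) (p : Heis n) : ℂ :=
  heatKernel n (1 / 2) lam (ζ - toC p.1) *
    Complex.exp (-Complex.I * ((lam : ℂ) / 2) * sympC ζ (toC p.1)) *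
    Complex.exp (Complex.I * (lam : ℂ) * (p.2 : ℂ))

/-- The exponent of the kernel `fullKernel`. -/
noncomputable def kernelExponent {n : ℕ} (lam : ℝ) (ζ : C2 n) (p : Heis n) : ℂ :=
  -(1 / 4) * (lam : ℂ) * (coth (1 / 2 * lam) : ℂ) * ∑ i, (ζ i - (p.1 i : ℂ)) ^ 2 +
    -Complex.I * ((lam : ℂ) / 2) *
      ∑ j, (ζ (.inr j) * (p.1 (.inl j) : ℂ) - (p.1 (.inr j) : ℂ) * ζ (.inl j)) +
    Complex.I * (lam : ℂ) * (p.2 : ℂ)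

theorem fullKernel_eq {n : ℕ} (lam : ℝ) (ζ : C2 n) (p : Heis n) :
    fullKernel lam ζ p = heatConst n (1 / 2) lam * Complex.exp (kernelExponent lam ζ p) := by
  rw [fullKernel, kernelExponent, Complex.exp_add, Complex.exp_add, heatKernel, heatConst]
  simp only [toC, sympC, PiLp.sub_apply]
  ring

theorem continuous_fullKernel {n : ℕ} (lam : ℝ) (ζ : C2 n) : Continuous (fullKernel lam ζ) := by
  have : fullKernel lam ζ = fun p =>
      heatConst n (1 / 2) lam * Complex.exp (kernelExponent lam ζ p) :=
    funext fun p => fullKernel_eq lam ζ p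
  rw [this]
  unfold kernelExponent
  fun_prop

/-- The derivative of `kernelExponent` at `p` in the direction `v`. -/
noncomputable def kernelExponentDeriv {n : ℕ} (lam : ℝ) (ζ : C2 n) (v p : Heis n) : ℂ :=
  (1 / 2) * (lam : ℂ) * (coth (1 / 2 * lam) : ℂ) * ∑ i, (v.1 i : ℂ) * (ζ i - (p.1 i : ℂ)) +
    -Complex.I * ((lam : ℂ) / 2) *
      ∑ j, (ζ (.inr j) * (v.1 (.inl j) : ℂ) - (v.1 (.inr j) : ℂ) * ζ (.inl j)) +
    Complex.I * (lam : ℂ) * (v.2 : ℂ)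

theorem hasDerivAt_ofReal_add_mul (a v : ℝ) :
    HasDerivAt (fun t : ℝ => ((a + t * v : ℝ) : ℂ)) (v : ℂ) 0 := by
  have : HasDerivAt (fun t : ℝ => a + t * v) v 0 := by
    simpa using ((hasDerivAt_id (0 : ℝ)).mul_const v).const_add a
  exact this.ofReal_comp

theorem hasLineDerivAt_kernelExponent {n : ℕ} (lam : ℝ) (ζ : C2 n) (v p : Heis n) :
    HasLineDerivAt ℝ (kernelExponent lam ζ) (kernelExponentDeriv lam ζ v p) p v := by
  unfold HasLineDerivAt kernelExponent
  simp only [Prod.fst_add, Prod.snd_add, Prod.smul_fst, Prod.smul_snd, PiLp.add_apply,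
    PiLp.smul_apply, smul_eq_mul]
  have h1 : HasDerivAt (fun t : ℝ => ∑ i, (ζ i - ((p.1 i + t * v.1 i : ℝ) : ℂ)) ^ 2)
      (∑ i, -2 * ((v.1 i : ℂ) * (ζ i - (p.1 i : ℂ)))) 0 := by
    refine HasDerivAt.fun_sum fun i _ => ?_
    refine (((hasDerivAt_ofReal_add_mul (p.1 i) (v.1 i)).const_sub (ζ i)).fun_pow 2).congr_deriv ?_
    push_cast
    simp
    ring
  have h2 : HasDerivAt (fun t : ℝ => ∑ j, (ζ (.inr j) * ((p.1 (.inl j) + t * v.1 (.inl j) : ℝ) : ℂ)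
        - ((p.1 (.inr j) + t * v.1 (.inr j) : ℝ) : ℂ) * ζ (.inl j)))
      (∑ j, (ζ (.inr j) * (v.1 (.inl j) : ℂ) - (v.1 (.inr j) : ℂ) * ζ (.inl j))) 0 :=
    HasDerivAt.fun_sum fun j _ =>
      ((hasDerivAt_ofReal_add_mul (p.1 (.inl j)) (v.1 (.inl j))).const_mul _).sub
        ((hasDerivAt_ofReal_add_mul (p.1 (.inr j)) (v.1 (.inr j))).mul_const _)
  have h3 := hasDerivAt_ofReal_add_mul p.2 v.2
  refine (((h1.const_mul (-(1 / 4) * (lam : ℂ) * (coth (1 / 2 * lam) : ℂ))).add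
    (h2.const_mul (-Complex.I * ((lam : ℂ) / 2)))).add
    (h3.const_mul (Complex.I * (lam : ℂ)))).congr_deriv ?_
  rw [kernelExponentDeriv, ← Finset.mul_sum]
  ring

theorem hasLineDerivAt_fullKernel {n : ℕ} (lam : ℝ) (ζ : C2 n) (v p : Heis n) :
    HasLineDerivAt ℝ (fullKernel lam ζ) (kernelExponentDeriv lam ζ v p * fullKernel lam ζ p) p v := by
  have : fullKernel lam ζ = fun p =>
      heatConst n (1 / 2) lam * Complex.exp (kernelExponent lam ζ p) :=
    funext fun p => fullKernel_eq lam ζ p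
  rw [this]
  have h := hasLineDerivAt_kernelExponent lam ζ v p
  unfold HasLineDerivAt at h ⊢
  refine (h.cexp.const_mul (heatConst n (1 / 2) lam : ℂ)).congr_deriv ?_
  simp only [zero_smul, add_zero]
  ring

/-! ### The uniform Gaussian bound. -/

/-- With `b = coth (λ/2)` one has `coth λ = (b + b⁻¹)/2`, and the exponent becomes `-λ/(4b)` times a
sum of squares. It vanishes at `η = (Re z + Im w / b, Re w - Im z / b)`, so the weight matches the
kernel with no exponential loss. -/
theorem gaussian_exponent_nonpos {n : ℕ} {lam : ℝ} (h : lam ≠ 0) (ζ : C2 n) (η : R2 n) :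
    (1 / 4) * lam * coth lam * (∑ i, (ζ i ^ 2).re) - (1 / 4) * lam * coth lam * ‖ζ‖ ^ 2
      + (1 / 2) * lam * symp (rePart ζ) (imPart ζ)
      - (1 / 4) * lam * coth (1 / 2 * lam) * (∑ i, ((ζ i - (η i : ℂ)) ^ 2).re)
      + (1 / 2) * lam * symp (imPart ζ) η ≤ 0 := by
  have hx : (1 / 2 * lam) ≠ 0 := by simpa using h
  set b := coth (1 / 2 * lam) with hb
  have hbpos : 0 < lam * b := by linarith [mul_coth_pos hx]
  have hb0 : b ≠ 0 := fun h0 => by simp [h0] at hbpos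
  have ha : coth lam = (b + b⁻¹) / 2 := by
    rw [hb, ← coth_double hx]; ring_nf
  have hr : 0 < lam * b⁻¹ := by
    have : lam * b⁻¹ = lam * b * (b⁻¹) ^ 2 := by field_simp
    rw [this]; positivity
  have key : (1 / 4) * lam * coth lam * (∑ i, (ζ i ^ 2).re) - (1 / 4) * lam * coth lam * ‖ζ‖ ^ 2
      + (1 / 2) * lam * symp (rePart ζ) (imPart ζ)
      - (1 / 4) * lam * b * (∑ i, ((ζ i - (η i : ℂ)) ^ 2).re)
      + (1 / 2) * lam * symp (imPart ζ) η =
      ∑ j, -((1 / 4) * (lam * b⁻¹) *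
        ((b * (η (.inl j) - (ζ (.inl j)).re) - (ζ (.inr j)).im) ^ 2 +
          (b * (η (.inr j) - (ζ (.inr j)).re) + (ζ (.inl j)).im) ^ 2)) := by
    rw [EuclideanSpace.norm_sq_eq, ha]
    simp only [Fintype.sum_sum_type, symp, rePart, imPart, Finset.mul_sum,
      ← Finset.sum_add_distrib, ← Finset.sum_sub_distrib]
    refine Finset.sum_congr rfl fun j _ => ?_
    simp only [← Complex.normSq_eq_norm_sq]
    simp only [Complex.normSq_apply, pow_two, Complex.mul_re,
      Complex.sub_re, Complex.sub_im, Complex.ofReal_re, Complex.ofReal_im]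
    field_simp
    ring
  rw [key]
  exact Finset.sum_nonpos fun j _ => neg_nonpos.2 (by positivity)

theorem norm_fullKernel {n : ℕ} {lam : ℝ} (h : lam ≠ 0) (ζ : C2 n) (p : Heis n) :
    ‖fullKernel lam ζ p‖ = heatConst n (1 / 2) lam * Real.exp
      (-(1 / 4) * lam * coth (1 / 2 * lam) * (∑ i, ((ζ i - (p.1 i : ℂ)) ^ 2).re)
      + (1 / 2) * lam * symp (imPart ζ) p.1) := by
  rw [fullKernel_eq, norm_mul, Complex.norm_exp, Complex.norm_real,
    Real.norm_of_nonneg (heatConst_half_pos n h).le]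
  congr 2
  have h1 : (-(1 / 4) * (lam : ℂ) * (coth (1 / 2 * lam) : ℂ))
      = ((-(1 / 4) * lam * coth (1 / 2 * lam) : ℝ) : ℂ) := by push_cast; ring
  have h2 : ∀ s : ℂ, (-Complex.I * ((lam : ℂ) / 2) * s).re = 1 / 2 * lam * s.im := by
    intro s
    have : -Complex.I * ((lam : ℂ) / 2) * s = ((1 / 2 * lam : ℝ) : ℂ) * (-Complex.I * s) := by
      push_cast; ring
    rw [this, Complex.re_ofReal_mul]
    simp
  have h3 : (Complex.I * (lam : ℂ) * (p.2 : ℂ)).re = 0 := by simp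
  rw [kernelExponent, Complex.add_re, Complex.add_re, h1, Complex.re_ofReal_mul, h2, h3,
    Complex.re_sum, Complex.im_sum, add_zero]
  congr 2
  rw [symp]
  refine Finset.sum_congr rfl fun j _ => ?_
  simp [imPart]

/-- The factor by which the absolute value of the twisted convolution is multiplied in
`|B_λ g| √w_λ`. -/
noncomputable def damping {n : ℕ} (lam : ℝ) (ζ : C2 n) : ℝ :=
  ‖(cConst n lam : ℂ) * (heatKernel n 1 lam ζ)⁻¹‖ * √(weight lam ζ)

theorem damping_nonneg {n : ℕ} (lam : ℝ) (ζ : C2 n) : 0 ≤ damping lam ζ := by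
  unfold damping; positivity

theorem damping_eq {n : ℕ} {lam : ℝ} (h : lam ≠ 0) (ζ : C2 n) :
    damping lam ζ = √(cConst n lam) * Real.exp
      ((1 / 4) * lam * coth lam * (∑ i, (ζ i ^ 2).re) - (1 / 4) * lam * coth lam * ‖ζ‖ ^ 2
      + (1 / 2) * lam * symp (rePart ζ) (imPart ζ)) := by
  have hc := cConst_pos n h
  have h1 : ‖heatKernel n 1 lam ζ‖ =
      cConst n lam * Real.exp (-((1 / 4) * lam * coth lam * (∑ i, (ζ i ^ 2).re))) := by
    have e : (-(1 / 4) * (lam : ℂ) * (coth (1 * lam) : ℂ))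
      = ((-(1 / 4) * lam * coth lam : ℝ) : ℂ) := by push_cast; ring_nf
    rw [heatKernel, norm_mul, Complex.norm_exp, Complex.norm_real, e, Complex.re_ofReal_mul,
      Complex.re_sum, one_mul, ← cConst, Real.norm_of_nonneg hc.le]
    congr 2; ring
  have h2 : √(weight lam ζ) = √(cConst n lam) *
      Real.exp (-(1 / 4) * lam * coth lam * ‖ζ‖ ^ 2
        + (1 / 2) * lam * symp (rePart ζ) (imPart ζ)) := by
    rw [weight, mul_assoc, Real.sqrt_mul hc.le, ← Real.exp_add, ← Real.exp_half]
    congr 2; ring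
  rw [damping, norm_mul, norm_inv, h1, h2, Complex.norm_real, Real.norm_of_nonneg hc.le, mul_inv,
    ← Real.exp_neg, neg_neg, mul_inv_cancel_left₀ hc.ne', mul_left_comm, ← Real.exp_add]
  congr 2; ring

theorem damping_mul_norm_fullKernel_le {n : ℕ} {lam : ℝ} (h : lam ≠ 0) (ζ : C2 n) (p : Heis n) :
    damping lam ζ * ‖fullKernel lam ζ p‖ ≤ cConst n lam * (1 + lam ^ 2) ^ n := by
  refine le_trans ?_ (sqrt_cConst_mul_heatConst_le n h)
  rw [damping_eq h, norm_fullKernel h, mul_mul_mul_comm, ← Real.exp_add]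
  refine mul_le_of_le_one_right
    (mul_nonneg (Real.sqrt_nonneg _) (heatConst_half_pos n h).le) (Real.exp_le_one_iff.2 ?_)
  linarith [gaussian_exponent_nonpos h ζ p.1]

theorem damping_pos {n : ℕ} {lam : ℝ} (h : lam ≠ 0) (ζ : C2 n) : 0 < damping lam ζ := by
  have := cConst_pos n h
  rw [damping_eq h]; positivity

/-- For fixed `ζ` the kernel is bounded on the whole group, so its product with any Schwartz
function is integrable. -/
theorem norm_fullKernel_le {n : ℕ} {lam : ℝ} (h : lam ≠ 0) (ζ : C2 n) (p : Heis n) :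
    ‖fullKernel lam ζ p‖ ≤ cConst n lam * (1 + lam ^ 2) ^ n / damping lam ζ := by
  rw [le_div_iff₀' (damping_pos h ζ)]
  exact damping_mul_norm_fullKernel_le h ζ p

/-! ### Pairing with the kernel and integration by parts. -/

/-- The pairing of a function on the Heisenberg group with `fullKernel`. -/
noncomputable def kernelPairing {n : ℕ} (lam : ℝ) (ζ : C2 n) (f : Heis n → ℂ) : ℂ :=
  ∫ p, f p * fullKernel lam ζ p

instance isAddHaarMeasure_volume_heis (n : ℕ) :
    (volume : Measure (Heis n)).IsAddHaarMeasure :=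
  inferInstanceAs ((volume : Measure (R2 n)).prod (volume : Measure ℝ)).IsAddHaarMeasure

theorem integrable_mul_fullKernel {n : ℕ} {lam : ℝ} (h : lam ≠ 0) (ζ : C2 n)
    (f : 𝓢(Heis n, ℂ)) : Integrable (fun p => f p * fullKernel lam ζ p) :=
  f.integrable.mul_bdd (continuous_fullKernel lam ζ).aestronglyMeasurable
    (Filter.Eventually.of_forall (norm_fullKernel_le h ζ))

theorem twistedConv_centralFourier {n : ℕ} {lam : ℝ} (h : lam ≠ 0) (ζ : C2 n)
    (f : 𝓢(Heis n, ℂ)) :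
    twistedConv lam (centralFourier f lam) (heatKernel n (1 / 2) lam) ζ
      = kernelPairing lam ζ f := by
  rw [kernelPairing, Measure.volume_eq_prod, integral_prod]
  · refine integral_congr_ae (Filter.Eventually.of_forall fun η => ?_)
    simp only [centralFourier]
    rw [mul_assoc, ← integral_mul_const]
    refine integral_congr_ae (Filter.Eventually.of_forall fun t => ?_)
    simp only [fullKernel]
    ring
  · exact integrable_mul_fullKernel h ζ f

theorem norm_bargmann_mul_sqrt_weight {n : ℕ} {lam : ℝ} (h : lam ≠ 0) (ζ : C2 n)
    (f : 𝓢(Heis n, ℂ)) :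
    ‖bargmann lam (centralFourier f lam) ζ‖ * √(weight lam ζ)
      = damping lam ζ * ‖kernelPairing lam ζ f‖ := by
  rw [bargmann, twistedConv_centralFourier h, norm_mul, damping]
  ring

theorem damping_mul_norm_kernelPairing_le {n : ℕ} {lam : ℝ} (h : lam ≠ 0) (ζ : C2 n)
    (f : 𝓢(Heis n, ℂ)) :
    damping lam ζ * ‖kernelPairing lam ζ f‖
      ≤ (∫ p, ‖f p‖) * (cConst n lam * (1 + lam ^ 2) ^ n) := by
  have h1 : ‖kernelPairing lam ζ f‖
      ≤ (∫ p, ‖f p‖) * (cConst n lam * (1 + lam ^ 2) ^ n / damping lam ζ) := by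
    rw [← integral_mul_const]
    refine norm_integral_le_of_norm_le (f.integrable.norm.mul_const _)
      (Filter.Eventually.of_forall fun p => ?_)
    rw [norm_mul]
    gcongr
    exact norm_fullKernel_le h ζ p
  have := mul_le_mul_of_nonneg_left h1 (damping_nonneg lam ζ)
  refine this.trans_eq ?_
  field_simp [(damping_pos h ζ).ne']

/-- Multiplication by the `i`-th coordinate of `ℝ²ⁿ`. -/
noncomputable def mulCoord {n : ℕ} (i : Fin n ⊕ Fin n) (f : 𝓢(Heis n, ℂ)) : 𝓢(Heis n, ℂ) :=
  SchwartzMap.smulLeftCLM ℂ (fun p : Heis n => p.1 i) f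

theorem mulCoord_apply {n : ℕ} (i : Fin n ⊕ Fin n) (f : 𝓢(Heis n, ℂ)) (p : Heis n) :
    mulCoord i f p = (p.1 i : ℂ) * f p := by
  rw [mulCoord, SchwartzMap.smulLeftCLM_apply_apply, Complex.real_smul]
  exact ((EuclideanSpace.proj i : R2 n →L[ℝ] ℝ).comp
    (ContinuousLinearMap.fst ℝ (R2 n) ℝ)).hasTemperateGrowth

/-- Integration by parts: differentiating the kernel multiplies it by a polynomial affine in `ζ` and
in the integration point, and the latter's coordinates are absorbed into `f` by `mulCoord`. -/
theorem kernelPairing_lineDeriv {n : ℕ} {lam : ℝ} (h : lam ≠ 0) (ζ : C2 n)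
    (f : 𝓢(Heis n, ℂ)) (v : Heis n) :
    kernelPairing lam ζ (∂_{v} f : 𝓢(Heis n, ℂ)) = -((1 / 2) * (lam : ℂ) * (coth (1 / 2 * lam) : ℂ) *
        ∑ i, (v.1 i : ℂ) * (ζ i * kernelPairing lam ζ f - kernelPairing lam ζ (mulCoord i f)) +
      (-Complex.I * ((lam : ℂ) / 2) *
        ∑ j, (ζ (.inr j) * (v.1 (.inl j) : ℂ) - (v.1 (.inr j) : ℂ) * ζ (.inl j)) +
        Complex.I * (lam : ℂ) * (v.2 : ℂ)) * kernelPairing lam ζ f) := by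
  have hi := integrable_mul_fullKernel h ζ
  have hI1 : ∀ i, Integrable fun p => (v.1 i : ℂ) * (ζ i * (f p * fullKernel lam ζ p)
      - mulCoord i f p * fullKernel lam ζ p) := fun i =>
    (((hi f).const_mul (ζ i)).sub (hi (mulCoord i f))).const_mul (v.1 i : ℂ)
  have hI2 := (integrable_finsetSum Finset.univ fun i _ => hI1 i).const_mul
    ((1 / 2) * (lam : ℂ) * (coth (1 / 2 * lam) : ℂ))
  have hI3 := (hi f).const_mul (-Complex.I * ((lam : ℂ) / 2) *
        ∑ j, (ζ (.inr j) * (v.1 (.inl j) : ℂ) - (v.1 (.inr j) : ℂ) * ζ (.inl j)) +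
        Complex.I * (lam : ℂ) * (v.2 : ℂ))
  have heq : (fun p => f p * (kernelExponentDeriv lam ζ v p * fullKernel lam ζ p)) = fun p =>
      (1 / 2) * (lam : ℂ) * (coth (1 / 2 * lam) : ℂ) *
        (∑ i, (v.1 i : ℂ) * (ζ i * (f p * fullKernel lam ζ p)
          - mulCoord i f p * fullKernel lam ζ p)) +
      (-Complex.I * ((lam : ℂ) / 2) *
        ∑ j, (ζ (.inr j) * (v.1 (.inl j) : ℂ) - (v.1 (.inr j) : ℂ) * ζ (.inl j)) +
        Complex.I * (lam : ℂ) * (v.2 : ℂ)) * (f p * fullKernel lam ζ p) := by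
    funext p
    have : ∑ i, (v.1 i : ℂ) * (ζ i * (f p * fullKernel lam ζ p)
          - mulCoord i f p * fullKernel lam ζ p) =
        (∑ i, (v.1 i : ℂ) * (ζ i - (p.1 i : ℂ))) * (f p * fullKernel lam ζ p) := by
      rw [Finset.sum_mul]
      refine Finset.sum_congr rfl fun i _ => ?_
      rw [mulCoord_apply]; ring
    rw [this, kernelExponentDeriv]
    ring
  have hparts := integral_bilinear_hasLineDerivAt_right_eq_neg_left_of_integrable
    (μ := (volume : Measure (Heis n))) (f := f) (f' := fun p => (∂_{v} f : 𝓢(Heis n, ℂ)) p)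
    (g := fullKernel lam ζ) (g' := fun p => kernelExponentDeriv lam ζ v p * fullKernel lam ζ p)
    (v := v) (B := ContinuousLinearMap.mul ℝ ℂ) (hi _)
    (by simp only [ContinuousLinearMap.mul_apply']; rw [heq]; exact hI2.add hI3) (hi f)
    (fun p _ => by
      rw [SchwartzMap.lineDerivOp_apply_eq_fderiv]
      exact f.differentiableAt.hasFDerivAt.hasLineDerivAt v)
    (fun p _ => hasLineDerivAt_fullKernel lam ζ v p)
  simp only [ContinuousLinearMap.mul_apply'] at hparts
  rw [heq, integral_add hI2 hI3, integral_const_mul, integral_const_mul,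
    integral_finsetSum _ fun i _ => hI1 i] at hparts
  rw [kernelPairing, ← neg_eq_iff_eq_neg, ← hparts]
  congr 2
  refine Finset.sum_congr rfl fun i _ => ?_
  rw [integral_const_mul, integral_sub ((hi f).const_mul (ζ i)) (hi (mulCoord i f)),
    integral_const_mul]
  rfl

/-- The partial derivative along the `i`-th coordinate of `ℝ²ⁿ`. -/
noncomputable def coordDeriv {n : ℕ} (i : Fin n ⊕ Fin n) (f : 𝓢(Heis n, ℂ)) : 𝓢(Heis n, ℂ) :=
  ∂_{((EuclideanSpace.single i 1, 0) : Heis n)} f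

/-- The partial derivative along the central variable. -/
noncomputable def centralDeriv {n : ℕ} (f : 𝓢(Heis n, ℂ)) : 𝓢(Heis n, ℂ) :=
  ∂_{((0, 1) : Heis n)} f

theorem kernelPairing_centralDeriv {n : ℕ} {lam : ℝ} (h : lam ≠ 0) (ζ : C2 n)
    (f : 𝓢(Heis n, ℂ)) :
    kernelPairing lam ζ (centralDeriv f) = -(Complex.I * lam * kernelPairing lam ζ f) := by
  rw [centralDeriv, kernelPairing_lineDeriv h]
  simp

theorem kernelPairing_coordDeriv_inl {n : ℕ} {lam : ℝ} (h : lam ≠ 0) (ζ : C2 n)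
    (f : 𝓢(Heis n, ℂ)) (j : Fin n) :
    kernelPairing lam ζ (coordDeriv (.inl j) f) =
      -((lam / 2 : ℂ) * (coth (1 / 2 * lam) : ℂ) *
        (ζ (.inl j) * kernelPairing lam ζ f - kernelPairing lam ζ (mulCoord (.inl j) f)) -
        Complex.I * (lam / 2 : ℂ) * ζ (.inr j) * kernelPairing lam ζ f) := by
  rw [coordDeriv, kernelPairing_lineDeriv h]
  simp [apply_ite Complex.ofReal, Finset.sum_sub_distrib, mul_sub]
  ring

theorem kernelPairing_coordDeriv_inr {n : ℕ} {lam : ℝ} (h : lam ≠ 0) (ζ : C2 n)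
    (f : 𝓢(Heis n, ℂ)) (j : Fin n) :
    kernelPairing lam ζ (coordDeriv (.inr j) f) =
      -((lam / 2 : ℂ) * (coth (1 / 2 * lam) : ℂ) *
        (ζ (.inr j) * kernelPairing lam ζ f - kernelPairing lam ζ (mulCoord (.inr j) f)) +
        Complex.I * (lam / 2 : ℂ) * ζ (.inl j) * kernelPairing lam ζ f) := by
  rw [coordDeriv, kernelPairing_lineDeriv h]
  simp [apply_ite Complex.ofReal, Finset.sum_sub_distrib, mul_sub]
  ring

theorem one_add_sq_mul_kernelPairing {n : ℕ} {lam : ℝ} (h : lam ≠ 0) (ζ : C2 n)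
    (f : 𝓢(Heis n, ℂ)) :
    ((1 + lam ^ 2 : ℝ) : ℂ) * kernelPairing lam ζ f
      = kernelPairing lam ζ f - kernelPairing lam ζ (centralDeriv (centralDeriv f)) := by
  rw [kernelPairing_centralDeriv h, kernelPairing_centralDeriv h]
  push_cast
  linear_combination ((lam : ℂ) ^ 2 * kernelPairing lam ζ f) * Complex.I_sq

/-! ### Solving for multiplication by the coordinates of `ζ`. -/

/-- Up to the factor `e^|λ|`, this bounds the pairing with `f` times the coordinates of `ζ` with
indices `.inl j` and `.inr j`. -/
noncomputable def coordBound {n : ℕ} (lam : ℝ) (ζ : C2 n) (f : 𝓢(Heis n, ℂ)) (j : Fin n) : ℝ :=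
  ‖kernelPairing lam ζ (mulCoord (.inl j) f)‖ + ‖kernelPairing lam ζ (mulCoord (.inr j) f)‖ +
  ‖kernelPairing lam ζ (coordDeriv (.inl j) f)‖ + ‖kernelPairing lam ζ (coordDeriv (.inr j) f)‖

/-- The coefficients are those of the inverted system. Each is a product of two factors among `cosh
x`, `sinh x` and `sinh x / x`, all bounded by `e^{|x|}`; keeping the quotient `sinh x / x` intact
avoids a singularity as `x → 0`. -/
theorem hyperbolic_combination_bound {x : ℝ} (hx : x ≠ 0) (a b c d : ℂ) {e : ℂ} (he : ‖e‖ = 1) :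
    ‖(Real.cosh x ^ 2 : ℝ) * a + e * (Real.cosh x * Real.sinh x : ℝ) * b
      - (Real.cosh x * (Real.sinh x / x) : ℝ) * c - e * (Real.sinh x * (Real.sinh x / x) : ℝ) * d‖
      ≤ Real.exp (2 * |x|) * (‖a‖ + ‖b‖ + ‖c‖ + ‖d‖) := by
  have hs := abs_sinh_le_exp x
  have hc : |Real.cosh x| ≤ Real.exp |x| := by
    rw [abs_of_pos (Real.cosh_pos x)]; exact cosh_le_exp_abs x
  have hq : |Real.sinh x / x| ≤ Real.exp |x| := by
    rw [abs_div, div_le_iff₀' (abs_pos.2 hx)]; exact abs_sinh_le_abs_mul_exp x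
  have h2 : Real.exp (2 * |x|) = Real.exp |x| * Real.exp |x| := by
    rw [← Real.exp_add]; ring_nf
  have hm : ∀ {u v : ℝ}, |u| ≤ Real.exp |x| → |v| ≤ Real.exp |x| →
      |u * v| ≤ Real.exp (2 * |x|) := by
    intro u v hu hv
    rw [h2, abs_mul]
    gcongr
  have hterm : ∀ {u : ℝ} (z : ℂ), |u| ≤ Real.exp (2 * |x|) →
      ‖(u : ℂ) * z‖ ≤ Real.exp (2 * |x|) * ‖z‖ := by
    intro u z hu
    rw [norm_mul, Complex.norm_real]
    exact mul_le_mul_of_nonneg_right hu (norm_nonneg _)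
  have ha := hterm (u := Real.cosh x ^ 2) a (by rw [pow_two]; exact hm hc hc)
  have hb := hterm b (hm hc hs)
  have hc' := hterm c (hm hc hq)
  have hd := hterm d (hm hs hq)
  have e1 : ∀ u z : ℂ, ‖e * u * z‖ = ‖u * z‖ := by
    intro u z; rw [mul_assoc, norm_mul, he, one_mul]
  refine (norm_sub_le _ _).trans ?_
  refine (add_le_add_left ((norm_sub_le _ _).trans (add_le_add_left (norm_add_le _ _) _)) _).trans ?_
  rw [e1, e1]
  linarith

theorem norm_coord_mul_kernelPairing_le {n : ℕ} {lam : ℝ} (h : lam ≠ 0) (ζ : C2 n)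
    (f : 𝓢(Heis n, ℂ)) (j : Fin n) :
    ‖ζ (.inl j)‖ * ‖kernelPairing lam ζ f‖ ≤ Real.exp |lam| * coordBound lam ζ f j ∧
    ‖ζ (.inr j)‖ * ‖kernelPairing lam ζ f‖ ≤ Real.exp |lam| * coordBound lam ζ f j := by
  have hx : (1 / 2 * lam) ≠ 0 := by simpa using h
  have hE : Real.exp |lam| = Real.exp (2 * |1 / 2 * lam|) := by
    rw [abs_mul, abs_of_pos (by norm_num : (0 : ℝ) < 1 / 2)]; ring_nf
  have h1 := kernelPairing_coordDeriv_inl h ζ f j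
  have h2 := kernelPairing_coordDeriv_inr h ζ f j
  set x := 1 / 2 * lam with hxdef
  have hl : lam = 2 * x := by rw [hxdef]; ring
  have hl' : (lam : ℂ) / 2 = x := by rw [hl]; push_cast; ring
  have hxC : (x : ℂ) ≠ 0 := by exact_mod_cast hx
  have hsC : (Real.sinh x : ℂ) ≠ 0 := by exact_mod_cast Real.sinh_ne_zero.2 hx
  have hcs : (Real.cosh x : ℂ) ^ 2 - (Real.sinh x : ℂ) ^ 2 = 1 := by
    exact_mod_cast Real.cosh_sq_sub_sinh_sq x
  have hcoth : (coth x : ℂ) * Real.sinh x = Real.cosh x := by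
    rw [coth, Complex.ofReal_div, div_mul_cancel₀ _ hsC]
  -- Scaling by `sinh x / x` gives the system the coefficients `cosh x` and `∓i sinh x`, with
  -- determinant `cosh² x - sinh² x = 1`.
  have hq : ∀ A B : ℂ, (Real.sinh x / x : ℂ) * -(x * coth x * A + B * x)
      = -(Real.cosh x * A + B * Real.sinh x) := by
    intro A B
    rw [← hcoth]
    field_simp
  rw [hl'] at h1 h2
  unfold coordBound
  set K := kernelPairing lam ζ f
  set Ml := kernelPairing lam ζ (mulCoord (.inl j) f)
  set Mr := kernelPairing lam ζ (mulCoord (.inr j) f)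
  set Dl := kernelPairing lam ζ (coordDeriv (.inl j) f)
  set Dr := kernelPairing lam ζ (coordDeriv (.inr j) f)
  set c := (coth x : ℂ)
  set z := ζ (.inl j)
  set w := ζ (.inr j)
  have qDl : (Real.sinh x / x : ℂ) * Dl
      = -(Real.cosh x * (z * K - Ml) - Complex.I * w * K * Real.sinh x) := by
    rw [h1, sub_eq_add_neg _ (_ * Real.sinh x : ℂ), ← neg_mul, ← hq]; ring
  have qDr : (Real.sinh x / x : ℂ) * Dr
      = -(Real.cosh x * (w * K - Mr) + Complex.I * z * K * Real.sinh x) := by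
    rw [h2, ← hq]; ring
  constructor
  · have key : z * K = (Real.cosh x ^ 2 : ℝ) * Ml + Complex.I * (Real.cosh x * Real.sinh x : ℝ) * Mr
        - (Real.cosh x * (Real.sinh x / x) : ℝ) * Dl
        - Complex.I * (Real.sinh x * (Real.sinh x / x) : ℝ) * Dr := by
      simp only [Complex.ofReal_mul, Complex.ofReal_div, Complex.ofReal_pow]
      linear_combination (-z * K) * hcs + Real.cosh x * qDl + Complex.I * Real.sinh x * qDr
        - (Real.sinh x ^ 2 * z * K) * Complex.I_sq
    rw [← norm_mul, key, hE]
    refine (hyperbolic_combination_bound hx Ml Mr Dl Dr (by simp)).trans_eq ?_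
    ring
  · have key : w * K = (Real.cosh x ^ 2 : ℝ) * Mr + -Complex.I * (Real.cosh x * Real.sinh x : ℝ) * Ml
        - (Real.cosh x * (Real.sinh x / x) : ℝ) * Dr
        - -Complex.I * (Real.sinh x * (Real.sinh x / x) : ℝ) * Dl := by
      simp only [Complex.ofReal_mul, Complex.ofReal_div, Complex.ofReal_pow]
      linear_combination (-w * K) * hcs + Real.cosh x * qDr - Complex.I * Real.sinh x * qDl
        - (Real.sinh x ^ 2 * w * K) * Complex.I_sq
    rw [← norm_mul, key, hE]
    refine (hyperbolic_combination_bound hx Mr Ml Dr Dl (by simp)).trans_eq ?_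
    ring

/-! ### Induction on the powers of `1 + λ²` and of `1 + |ζ|`. -/

theorem exists_damping_bound_lam {n : ℕ} (m : ℕ) (f : 𝓢(Heis n, ℂ)) :
    ∃ C : ℝ, ∀ lam : ℝ, lam ≠ 0 → ∀ ζ : C2 n,
      (1 + lam ^ 2) ^ m * (damping lam ζ * ‖kernelPairing lam ζ f‖)
        ≤ C * (cConst n lam * (1 + lam ^ 2) ^ n) := by
  induction m generalizing f with
  | zero =>
    refine ⟨∫ p, ‖f p‖, fun lam h ζ => ?_⟩
    simpa using damping_mul_norm_kernelPairing_le h ζ f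
  | succ m ih =>
    obtain ⟨C₁, h₁⟩ := ih f
    obtain ⟨C₂, h₂⟩ := ih (centralDeriv (centralDeriv f))
    refine ⟨C₁ + C₂, fun lam h ζ => ?_⟩
    have hpos : 0 ≤ 1 + lam ^ 2 := by positivity
    have h3 : (1 + lam ^ 2) * ‖kernelPairing lam ζ f‖ ≤ ‖kernelPairing lam ζ f‖ +
        ‖kernelPairing lam ζ (centralDeriv (centralDeriv f))‖ := by
      have := congrArg norm (one_add_sq_mul_kernelPairing h ζ f)
      rw [norm_mul, Complex.norm_real, Real.norm_of_nonneg hpos] at this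
      rw [this]
      exact norm_sub_le _ _
    have hd := damping_nonneg lam ζ
    have h4 := mul_le_mul_of_nonneg_left h3
      (mul_nonneg (pow_nonneg hpos m) hd)
    have := h₁ lam h ζ
    have := h₂ lam h ζ
    calc _ = (1 + lam ^ 2) ^ m * damping lam ζ * ((1 + lam ^ 2) * ‖kernelPairing lam ζ f‖) := by
          ring
      _ ≤ _ := by linarith

theorem norm_mul_kernelPairing_le {n : ℕ} {lam : ℝ} (h : lam ≠ 0) (ζ : C2 n)
    (f : 𝓢(Heis n, ℂ)) :
    (1 + ‖ζ‖) * ‖kernelPairing lam ζ f‖ ≤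
      Real.exp |lam| * (‖kernelPairing lam ζ f‖ + 2 * ∑ j, coordBound lam ζ f j) := by
  have hn : ‖ζ‖ ≤ ∑ i, ‖ζ i‖ := by
    rw [EuclideanSpace.norm_eq]
    refine Real.sqrt_le_iff.2 ⟨Finset.sum_nonneg fun i _ => norm_nonneg _, ?_⟩
    exact Finset.sum_sq_le_sq_sum_of_nonneg fun i _ => norm_nonneg _
  rw [Fintype.sum_sum_type] at hn
  have h1 : (∑ j : Fin n, ‖ζ (.inl j)‖) * ‖kernelPairing lam ζ f‖
      ≤ Real.exp |lam| * ∑ j, coordBound lam ζ f j := by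
    rw [Finset.sum_mul, Finset.mul_sum]
    exact Finset.sum_le_sum fun j _ => (norm_coord_mul_kernelPairing_le h ζ f j).1
  have h2 : (∑ j : Fin n, ‖ζ (.inr j)‖) * ‖kernelPairing lam ζ f‖
      ≤ Real.exp |lam| * ∑ j, coordBound lam ζ f j := by
    rw [Finset.sum_mul, Finset.mul_sum]
    exact Finset.sum_le_sum fun j _ => (norm_coord_mul_kernelPairing_le h ζ f j).2
  have h3 : (1 : ℝ) ≤ Real.exp |lam| := Real.one_le_exp (abs_nonneg _)
  have h4 := mul_le_mul_of_nonneg_right hn (norm_nonneg (kernelPairing lam ζ f))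
  have h5 := mul_le_mul_of_nonneg_right h3 (norm_nonneg (kernelPairing lam ζ f))
  linarith

theorem exists_damping_bound {n : ℕ} (m N : ℕ) (f : 𝓢(Heis n, ℂ)) :
    ∃ C : ℝ, ∀ lam : ℝ, lam ≠ 0 → ∀ ζ : C2 n,
      (1 + ‖ζ‖) ^ N * (damping lam ζ * ‖kernelPairing lam ζ f‖)
        ≤ C * (cConst n lam * ((1 + lam ^ 2) ^ m)⁻¹ * Real.exp (N * |lam|)) := by
  induction N generalizing f with
  | zero =>
    -- The extra `n` cancels the factor `(1 + λ²)^n` of the Gaussian bound.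
    obtain ⟨C, hC⟩ := exists_damping_bound_lam (m + n) f
    refine ⟨C, fun lam h ζ => ?_⟩
    have hpos : 0 < 1 + lam ^ 2 := by positivity
    have h1 := hC lam h ζ
    rw [pow_add, mul_right_comm, ← mul_assoc C] at h1
    have h2 := le_of_mul_le_mul_right h1 (pow_pos hpos n)
    simp only [pow_zero, one_mul, Nat.cast_zero, zero_mul, Real.exp_zero, mul_one]
    rw [← mul_assoc, ← div_eq_mul_inv, le_div_iff₀' (pow_pos hpos m)]
    exact h2
  | succ N ih =>
    -- The constant must be a function of the Schwartz function, since the step uses it at `f` and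
    -- at all its coordinate multiples and derivatives.
    choose C hC using ih
    refine ⟨C f + 2 * ∑ j, (C (mulCoord (.inl j) f) + C (mulCoord (.inr j) f) +
      C (coordDeriv (.inl j) f) + C (coordDeriv (.inr j) f)), fun lam h ζ => ?_⟩
    set A := cConst n lam * ((1 + lam ^ 2) ^ m)⁻¹ * Real.exp (N * |lam|) with hA
    set P := (1 + ‖ζ‖) ^ N * damping lam ζ with hP
    have hP0 : 0 ≤ P := mul_nonneg (by positivity) (damping_nonneg lam ζ)
    have hC' : ∀ g : 𝓢(Heis n, ℂ), P * ‖kernelPairing lam ζ g‖ ≤ C g * A := fun g => by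
      rw [hP, mul_assoc]; exact hC g lam h ζ
    have hsum : P * ∑ j, coordBound lam ζ f j ≤
        (∑ j, (C (mulCoord (.inl j) f) + C (mulCoord (.inr j) f) +
          C (coordDeriv (.inl j) f) + C (coordDeriv (.inr j) f))) * A := by
      rw [Finset.mul_sum, Finset.sum_mul]
      refine Finset.sum_le_sum fun j _ => ?_
      unfold coordBound
      linarith [hC' (mulCoord (.inl j) f), hC' (mulCoord (.inr j) f),
        hC' (coordDeriv (.inl j) f), hC' (coordDeriv (.inr j) f)]
    have h1 := mul_le_mul_of_nonneg_left (norm_mul_kernelPairing_le h ζ f) hP0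
    have h2 : P * (‖kernelPairing lam ζ f‖ + 2 * ∑ j, coordBound lam ζ f j) ≤
        (C f + 2 * ∑ j, (C (mulCoord (.inl j) f) + C (mulCoord (.inr j) f) +
          C (coordDeriv (.inl j) f) + C (coordDeriv (.inr j) f))) * A := by
      linarith [hC' f]
    have h3 : Real.exp ((N + 1 : ℕ) * |lam|) = Real.exp |lam| * Real.exp (N * |lam|) := by
      rw [← Real.exp_add]; push_cast; ring_nf
    calc _ = P * ((1 + ‖ζ‖) * ‖kernelPairing lam ζ f‖) := by rw [hP]; ring
      _ ≤ _ := h1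
      _ = Real.exp |lam| * (P * (‖kernelPairing lam ζ f‖ + 2 * ∑ j, coordBound lam ζ f j)) := by
          ring
      _ ≤ _ := mul_le_mul_of_nonneg_left h2 (Real.exp_pos _).le
      _ = _ := by rw [h3, hA]; ring

end TwistedBargmann

theorem mainTheorem11 (n : ℕ) (f : 𝓢(TwistedBargmann.Heis n, ℂ)) (m N : ℕ) :
    ∃ C : ℝ, ∀ lam : ℝ, lam ≠ 0 → ∀ ζ : TwistedBargmann.C2 n,
      ‖TwistedBargmann.bargmann lam (TwistedBargmann.centralFourier f lam) ζ‖ *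
          √(TwistedBargmann.weight lam ζ) ≤
        C * TwistedBargmann.cConst n lam * ((1 + lam ^ 2) ^ m)⁻¹ *
          Real.exp ((N : ℝ) * |lam|) * ((1 + ‖ζ‖) ^ N)⁻¹ := by
  obtain ⟨C, hC⟩ := TwistedBargmann.exists_damping_bound m N f
  refine ⟨C, fun lam h ζ => ?_⟩
  rw [TwistedBargmann.norm_bargmann_mul_sqrt_weight h, ← div_eq_mul_inv _ ((1 + ‖ζ‖) ^ N),
    le_div_iff₀' (by positivity)]
  refine (hC lam h ζ).trans_eq ?_
  ring
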